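/- A *cactus* is a finite simple graph in which any two distinct cycles have at most one common vertex. For $n \ge 1$ let $H_n$ be the graph obtained from the star $K_{1,n-1}$ (a single vertex if $n=1$) by adding $\lfloor (n-1)/2 \rfloor$ independent (pairwise disjoint) edges between pairs of pendant vertices. For a graph $G$ let $\rho(G)$, the *spectral radius* of $G$, be the largest eigenvalue of its adjacency matrix. **Theorem 2.3.** Let $n \ge 1$. Then $H_n$ is a connected cactus on $n$ vertices having the largest number of edges among all connected cacti on $n$ vertices. Moreover, if $G$ is any connected cactus on $n$ vertices having the largest number of edges among all connected cacti on $n$ vertices, then $$\rho(G) \le \rho(H_n),$$ and equality holds if and only if $G \cong H_n$. -/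

import Mathlib

namespace CactusIndex

variable {V : Type*}

/-- A cactus: any two different cycles have at most one common vertex. Cycles are compared as
subgraphs, so the base point and the orientation of a closed walk are irrelevant. -/
def IsCactus (G : SimpleGraph V) : Prop :=
  ∀ ⦃u v : V⦄ (p : G.Walk u u) (q : G.Walk v v), p.IsCycle → q.IsCycle →
    p.toSubgraph ≠ q.toSubgraph → (p.toSubgraph.verts ∩ q.toSubgraph.verts).Subsingleton

/-- A connected cactus whose number of edges is the largest possible among all connected cacti
on the same (finite) vertex set, i.e. of the same order. -/
structure IsMaxEdgeConnectedCactus (G : SimpleGraph V) : Prop where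
  connected : G.Connected
  isCactus : IsCactus G
  card_edges_le : ∀ G' : SimpleGraph V, G'.Connected → IsCactus G' →
    G'.edgeSet.ncard ≤ G.edgeSet.ncard

open Classical in
/-- The spectral radius (index) of a finite graph: the largest eigenvalue of its real adjacency
matrix. -/
noncomputable def rho [Fintype V] (G : SimpleGraph V) : ℝ :=
  sSup (spectrum ℝ (G.adjMatrix ℝ))

open Classical in
/-- If there is at least one vertex, the supremum in `rho` is a maximum. -/
theorem isGreatest_rho [Fintype V] [Nonempty V] (G : SimpleGraph V) :
    IsGreatest (spectrum ℝ (G.adjMatrix ℝ)) (rho G) := by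
  have hA := G.isHermitian_adjMatrix ℝ
  have h := hA.spectrum_real_eq_range_eigenvalues
  have hf : (spectrum ℝ (G.adjMatrix ℝ)).Finite := by
    rw [h]; exact Set.finite_range _
  have hne : (spectrum ℝ (G.adjMatrix ℝ)).Nonempty := by
    rw [h]; exact Set.range_nonempty _
  exact ⟨hne.csSup_mem hf, fun x hx => le_csSup hf.bddAbove hx⟩

/-- The graph `H_n`: the star with centre `0` and pendant vertices `1, …, n - 1`, together with the
independent edges `{1, 2}, {3, 4}, …`, as many as fit, that is `⌊(n - 1) / 2⌋` of them. -/
def H (n : ℕ) : SimpleGraph (Fin n) :=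
  SimpleGraph.fromRel fun i j => (i : ℕ) = 0 ∨ (Odd (i : ℕ) ∧ (j : ℕ) = (i : ℕ) + 1)

end CactusIndex

/-! Root a breadth-first tree of a connected cactus at `u`. An edge `ab` off the tree closes a cycle
through `a` and its parent, so two such edges at `a` would give distinct cycles sharing two
vertices. Hence the off-tree edges form a matching that avoids `u`
(`IsBreadthFirst.offTree_unique`). This bounds the number of edges by `(n - 1) + (n - 1) / 2`, which
`H n` attains.

For the index, let `x` be a positive eigenvector for `rho G` and take `u` where `x` is largest.
Replacing each tree edge from `v` to `p v` by one from `v` to `u`, and keeping the matching, does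
not decrease the quadratic form of `x`. By edge-maximality the matching misses at most one vertex
besides `u`, so the new graph is a windmill, and windmills of equal order are isomorphic. If the
indices agree, `x` is an eigenvector of both graphs. Comparing the entries at `u` shows that `u` is
adjacent in `G` to every other vertex, so nothing was changed. -/

namespace CactusIndex

variable {V : Type*}

/-! ### Rayleigh quotients and positive eigenvectors -/

section Spectral

open Matrix
open scoped Classical

variable [Fintype V] (G : SimpleGraph V)

theorem posSemidef_rho_sub_adjMatrix [Nonempty V] :
    (algebraMap ℝ (Matrix V V ℝ) (rho G) - G.adjMatrix ℝ).PosSemidef := by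
  refine posSemidef_iff_isHermitian_and_spectrum_nonneg.2 ⟨?_, ?_⟩
  · refine IsHermitian.sub ?_ (G.isHermitian_adjMatrix ℝ)
    rw [algebraMap_eq_diagonal]
    exact isHermitian_diagonal _
  · rw [← spectrum.singleton_sub_eq]
    rintro _ ⟨a, rfl, b, hb, rfl⟩
    exact sub_nonneg.2 ((isGreatest_rho G).2 hb)

theorem dotProduct_rho_sub_adjMatrix (x : V → ℝ) :
    x ⬝ᵥ ((algebraMap ℝ (Matrix V V ℝ) (rho G) - G.adjMatrix ℝ) *ᵥ x) =
      rho G * (x ⬝ᵥ x) - x ⬝ᵥ (G.adjMatrix ℝ *ᵥ x) := by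
  rw [sub_mulVec, dotProduct_sub, Algebra.algebraMap_eq_smul_one, smul_mulVec, one_mulVec,
    dotProduct_smul, smul_eq_mul]

theorem dotProduct_adjMatrix_mulVec_le [Nonempty V] (x : V → ℝ) :
    x ⬝ᵥ (G.adjMatrix ℝ *ᵥ x) ≤ rho G * (x ⬝ᵥ x) := by
  have h := (posSemidef_rho_sub_adjMatrix G).dotProduct_mulVec_nonneg x
  rw [star_trivial, dotProduct_rho_sub_adjMatrix] at h
  linarith

-- A vector at which a positive semidefinite form vanishes lies in the kernel of its matrix.
variable {G} in
theorem adjMatrix_mulVec_eq_of_le [Nonempty V] {x : V → ℝ}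
    (h : rho G * (x ⬝ᵥ x) ≤ x ⬝ᵥ (G.adjMatrix ℝ *ᵥ x)) : G.adjMatrix ℝ *ᵥ x = rho G • x := by
  have h0 := (posSemidef_rho_sub_adjMatrix G).dotProduct_mulVec_zero_iff x
  rw [star_trivial, dotProduct_rho_sub_adjMatrix] at h0
  have h1 := h0.1 (by linarith [dotProduct_adjMatrix_mulVec_le G x])
  rw [sub_mulVec, Algebra.algebraMap_eq_smul_one, smul_mulVec, one_mulVec, sub_eq_zero] at h1
  exact h1.symm

theorem dotProduct_adjMatrix_mulVec (x : V → ℝ) :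
    x ⬝ᵥ (G.adjMatrix ℝ *ᵥ x) = ∑ v, ∑ w, if G.Adj v w then x v * x w else 0 := by
  simp only [dotProduct, mulVec, SimpleGraph.adjMatrix_apply, Finset.mul_sum]
  refine Finset.sum_congr rfl fun v _ => Finset.sum_congr rfl fun w _ => ?_
  split_ifs <;> simp

-- At a zero entry the eigenvalue equation makes a sum of nonnegative neighbouring entries vanish,
-- so zeros spread along walks.
variable {G} in
theorem pos_of_adjMatrix_mulVec_eq (hG : G.Connected) {x : V → ℝ} {r : ℝ} (hx : ∀ v, 0 ≤ x v)
    (hx0 : x ≠ 0) (h : G.adjMatrix ℝ *ᵥ x = r • x) (v : V) : 0 < x v := by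
  have step : ∀ a b, G.Adj a b → x a = 0 → x b = 0 := by
    intro a b hab ha
    have h1 := congrFun h a
    rw [SimpleGraph.adjMatrix_mulVec_apply, Pi.smul_apply, ha, smul_zero,
      Finset.sum_eq_zero_iff_of_nonneg fun i _ => hx i] at h1
    exact h1 b (by simpa using hab)
  have walk : ∀ a b (_ : G.Walk a b), x a = 0 → x b = 0 := by
    intro a b p
    induction p with
    | nil => exact id
    | cons hab _ ih => exact fun ha => ih (step _ _ hab ha)
  refine (hx v).lt_of_ne' fun hv => hx0 (funext fun w => ?_)
  exact walk v w (hG.preconnected v w).some hv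

-- Taking absolute values of an eigenvector for `rho G` keeps its norm and does not lower the form,
-- so the result still attains the Rayleigh bound.
variable {G} in
theorem exists_pos_eigenvector (hG : G.Connected) :
    ∃ x : V → ℝ, (∀ v, 0 < x v) ∧ G.adjMatrix ℝ *ᵥ x = rho G • x := by
  have := hG.nonempty
  have hmem := (isGreatest_rho G).1
  rw [← spectrum_toLin', ← Module.End.hasEigenvalue_iff_mem_spectrum] at hmem
  obtain ⟨y, hy⟩ := hmem.exists_hasEigenvector
  have hy1 : G.adjMatrix ℝ *ᵥ y = rho G • y := by simpa using hy.apply_eq_smul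
  have habs : G.adjMatrix ℝ *ᵥ (fun v => |y v|) = rho G • fun v => |y v| := by
    apply adjMatrix_mulVec_eq_of_le
    have h1 : (fun v => |y v|) ⬝ᵥ (fun v => |y v|) = y ⬝ᵥ y := by
      simp [dotProduct]
    have h2 : y ⬝ᵥ (G.adjMatrix ℝ *ᵥ y) = rho G * (y ⬝ᵥ y) := by
      rw [hy1, dotProduct_smul, smul_eq_mul]
    rw [h1, ← h2, dotProduct_adjMatrix_mulVec, dotProduct_adjMatrix_mulVec]
    refine Finset.sum_le_sum fun v _ => Finset.sum_le_sum fun w _ => ?_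
    split_ifs
    · rw [← abs_mul]
      exact le_abs_self _
    · exact le_rfl
  refine ⟨_, pos_of_adjMatrix_mulVec_eq hG (fun v => abs_nonneg _) (fun h0 => hy.2 ?_) habs, habs⟩
  exact funext fun v => abs_eq_zero.1 (congrFun h0 v)

variable {G} in
theorem rho_congr {W : Type*} [Fintype W] {G' : SimpleGraph W} (e : G ≃g G') :
    rho G = rho G' := by
  have h : reindexAlgEquiv ℝ ℝ e.toEquiv (G.adjMatrix ℝ) = G'.adjMatrix ℝ := by
    ext v w
    simp only [coe_reindexAlgEquiv, reindex_apply, submatrix_apply, SimpleGraph.adjMatrix_apply]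
    exact if_congr e.symm.map_adj_iff rfl rfl
  rw [rho, rho, ← h, AlgEquiv.spectrum_eq]

end Spectral

/-! ### Windmills: uniqueness up to isomorphism and the cactus property -/

/-- A star centred at `u` together with a matching of the pendant vertices that leaves at most one
of them uncovered. -/
structure IsWindmill (K : SimpleGraph V) (u : V) : Prop where
  adj_center : ∀ v, v ≠ u → K.Adj u v
  matching : ∀ a b c, a ≠ u → b ≠ u → c ≠ u → K.Adj a b → K.Adj a c → b = c
  uncovered : ∀ v w, v ≠ u → w ≠ u → (∀ b, b ≠ u → ¬ K.Adj v b) → (∀ b, b ≠ u → ¬ K.Adj w b) →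
    v = w

/-- An involution with at most one fixed point consists of `card / 2` transpositions, so the
cardinality determines its cycle type and hence its conjugacy class. -/
theorem exists_equiv_of_sq_eq_one {S T : Type*} [Fintype S] [Fintype T]
    (hc : Fintype.card S = Fintype.card T) (σ : Equiv.Perm S) (τ : Equiv.Perm T)
    (hσ : σ ^ 2 = 1) (hτ : τ ^ 2 = 1) (hσ1 : ∀ v w, σ v = v → σ w = w → v = w)
    (hτ1 : ∀ v w, τ v = v → τ w = w → v = w) : ∃ e : S ≃ T, ∀ v, e (σ v) = τ (e v) := by
  classical
  have key : ∀ (α : Equiv.Perm S), α ^ 2 = 1 → (∀ v w, α v = v → α w = w → v = w) →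
      α.cycleType = Multiset.replicate (Fintype.card S / 2) 2 := by
    intro α hα hα1
    have h1 := Equiv.Perm.cycleType_of_pow_prime_eq_one (p := 2) hα
    have h2 := α.sum_cycleType
    rw [h1, Multiset.sum_replicate, smul_eq_mul] at h2
    have h3 : (α.supportᶜ).card ≤ 1 := by
      refine Finset.card_le_one.2 fun v hv w hw => hα1 v w ?_ ?_
      · simpa using hv
      · simpa using hw
    rw [Finset.card_compl] at h3
    have h4 := α.support.card_le_univ
    rw [h1]
    congr 1
    omega
  let e := Fintype.equivOfCardEq hc
  have hconj : IsConj σ (e.symm.permCongr τ) := by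
    rw [Equiv.Perm.isConj_iff_cycleType_eq, key σ hσ hσ1, key]
    · ext v
      have := congrArg (fun f : Equiv.Perm T => f (e v)) hτ
      simp only [sq, Equiv.Perm.mul_apply, Equiv.Perm.one_apply] at this
      simp [sq, this]
    · intro v w hv hw
      refine e.injective (hτ1 _ _ ?_ ?_)
      · simpa [Equiv.symm_apply_eq] using hv
      · simpa [Equiv.symm_apply_eq] using hw
  obtain ⟨g, hg⟩ := isConj_iff.1 hconj
  refine ⟨g.trans e, fun v => ?_⟩
  have := congrArg (fun f : Equiv.Perm S => f (g v)) hg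
  simp only [Equiv.Perm.mul_apply, Equiv.Perm.inv_def, Equiv.symm_apply_apply,
    Equiv.permCongr_apply, Equiv.symm_symm] at this
  simp [this]

namespace IsWindmill

variable {K : SimpleGraph V} {u : V}

/-- Encodes the matching as an involution, with the uncovered vertex, if any, as its fixed point. -/
theorem exists_partner (h : IsWindmill K u) : ∃ σ : Equiv.Perm {v // v ≠ u},
    (∀ v w : {v // v ≠ u}, K.Adj v w ↔ v ≠ w ∧ σ v = w) ∧ σ ^ 2 = 1 ∧
      ∀ v w, σ v = v → σ w = w → v = w := by
  classical
  let f : {v // v ≠ u} → {v // v ≠ u} := fun v =>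
    if hv : ∃ w : {v // v ≠ u}, K.Adj v w then hv.choose else v
  have hf : ∀ v w : {v // v ≠ u}, K.Adj v w → f v = w := by
    intro v w hvw
    have hv : ∃ w : {v // v ≠ u}, K.Adj v w := ⟨w, hvw⟩
    simp only [f, dif_pos hv]
    exact Subtype.ext (h.matching v.1 _ _ v.2 hv.choose.2 w.2 hv.choose_spec hvw)
  have hf' : ∀ v : {v // v ≠ u}, (∀ w : {v // v ≠ u}, ¬ K.Adj v w) → f v = v := by
    intro v hv
    exact dif_neg (not_exists.2 hv)
  have hinv : Function.Involutive f := by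
    intro v
    by_cases hv : ∃ w : {v // v ≠ u}, K.Adj v w
    · obtain ⟨w, hw⟩ := hv
      rw [hf v w hw, hf w v hw.symm]
    · push Not at hv
      rw [hf' v hv, hf' v hv]
  have hadj : ∀ v w : {v // v ≠ u}, v ≠ w → f v = w → K.Adj v w := by
    intro v w hvw hfv
    by_contra hn
    by_cases hv : ∃ w : {v // v ≠ u}, K.Adj v w
    · obtain ⟨w', hw⟩ := hv
      rw [hf v w' hw] at hfv
      exact hn (hfv ▸ hw)
    · push Not at hv
      exact hvw ((hf' v hv).symm.trans hfv)
  have hfix : ∀ v : {v // v ≠ u}, f v = v → ∀ b, b ≠ u → ¬ K.Adj v b := by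
    intro v hv b hb hvb
    have := hf v ⟨b, hb⟩ hvb
    rw [hv] at this
    subst this
    exact K.irrefl hvb
  refine ⟨hinv.toPerm f, fun v w => ⟨fun hvw => ⟨?_, hf v w hvw⟩, fun hvw => hadj v w hvw.1 hvw.2⟩,
    Equiv.ext fun v => hinv v, fun v w hv hw => ?_⟩
  · rintro rfl
    exact K.irrefl hvw
  · exact Subtype.ext (h.uncovered v w v.2 w.2 (hfix v hv) (hfix w hw))

theorem nonempty_iso {W : Type*} [Fintype V] [Fintype W] {L : SimpleGraph W} {z : W}
    (h : IsWindmill K u) (h' : IsWindmill L z) (hc : Fintype.card V = Fintype.card W) :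
    Nonempty (K ≃g L) := by
  classical
  obtain ⟨σ, hσ, hσ2, hσ1⟩ := h.exists_partner
  obtain ⟨τ, hτ, hτ2, hτ1⟩ := h'.exists_partner
  obtain ⟨e, he⟩ := exists_equiv_of_sq_eq_one (by simp [hc]) σ τ hσ2 hτ2 hσ1 hτ1
  -- `none` stands for the centre and `some` for the other vertices.
  have hadj : ∀ a b : Option {v // v ≠ u}, L.Adj (Equiv.optionSubtypeNe z (Equiv.optionCongr e a))
      (Equiv.optionSubtypeNe z (Equiv.optionCongr e b)) ↔
      K.Adj (Equiv.optionSubtypeNe u a) (Equiv.optionSubtypeNe u b) := by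
    rintro (_ | a) (_ | b)
    · simp
    · simp [h.adj_center b b.2, h'.adj_center (e b) (e b).2]
    · simp [(h.adj_center a a.2).symm, (h'.adj_center (e a) (e a).2).symm]
    · simp only [Equiv.optionCongr_apply, Option.map_some, Equiv.optionSubtypeNe_some]
      rw [hσ, hτ, ← he, e.apply_eq_iff_eq, e.injective.ne_iff]
  refine ⟨⟨(Equiv.optionSubtypeNe u).symm.trans
    ((Equiv.optionCongr e).trans (Equiv.optionSubtypeNe z)), fun {a b} => ?_⟩⟩
  have := hadj ((Equiv.optionSubtypeNe u).symm a) ((Equiv.optionSubtypeNe u).symm b)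
  rwa [Equiv.apply_symm_apply, Equiv.apply_symm_apply] at this

theorem connected (h : IsWindmill K u) : K.Connected := by
  have hu : ∀ v, K.Reachable u v := by
    intro v
    by_cases hv : v = u
    · rw [hv]
    · exact (h.adj_center v hv).reachable
  have : Nonempty V := ⟨u⟩
  exact SimpleGraph.Connected.mk fun v w => (hu v).symm.trans (hu w)

/-- A cycle has two edges at each of its vertices, and a non-centre vertex has only `u` and its
partner as possible neighbours. So the cycle is a triangle determined by `a`. -/
theorem cycle_eq (h : IsWindmill K u) {v : V} (p : K.Walk v v) (hp : p.IsCycle) {a : V}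
    (ha : a ∈ p.toSubgraph.verts) (hau : a ≠ u) :
    ∃ b, b ≠ u ∧ K.Adj a b ∧ p.toSubgraph.verts = {u, a, b} ∧
      ∀ x y, p.toSubgraph.Adj x y ↔ x ≠ y ∧ x ∈ ({u, a, b} : Set V) ∧ y ∈ ({u, a, b} : Set V) := by
  have two : ∀ x, x ∈ p.toSubgraph.verts → ∃ y z, y ≠ z ∧ p.toSubgraph.neighborSet x = {y, z} :=
    fun x hx => Set.ncard_eq_two.1
      (hp.ncard_neighborSet_toSubgraph_eq_two (p.mem_verts_toSubgraph.1 hx))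
  have main : ∀ a, a ∈ p.toSubgraph.verts → a ≠ u →
      ∃ b, b ≠ u ∧ K.Adj a b ∧ p.toSubgraph.neighborSet a = {u, b} := by
    intro a ha hau
    obtain ⟨y, z, hyz, hN⟩ := two a ha
    have hy : K.Adj a y := (show p.toSubgraph.Adj a y by
      rw [← SimpleGraph.Subgraph.mem_neighborSet, hN]; simp).adj_sub
    have hz : K.Adj a z := (show p.toSubgraph.Adj a z by
      rw [← SimpleGraph.Subgraph.mem_neighborSet, hN]; simp).adj_sub
    by_cases hyu : y = u
    · exact ⟨z, fun hzu => hyz (hyu.trans hzu.symm), hz, by rw [hN, hyu]⟩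
    · by_cases hzu : z = u
      · exact ⟨y, hyu, hy, by rw [hN, hzu, Set.pair_comm]⟩
      · exact absurd (h.matching a y z hau hyu hzu hy hz) hyz
  have adj_iff : ∀ x y, p.toSubgraph.Adj x y ↔ y ∈ p.toSubgraph.neighborSet x := fun x y => Iff.rfl
  obtain ⟨b, hbu, hab, hNa⟩ := main a ha hau
  have hSau : p.toSubgraph.Adj a u := by rw [adj_iff, hNa]; simp
  have hSab : p.toSubgraph.Adj a b := by rw [adj_iff, hNa]; simp
  have hb : b ∈ p.toSubgraph.verts := hSab.snd_mem
  have hu : u ∈ p.toSubgraph.verts := hSau.snd_mem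
  obtain ⟨a', ha'u, hba', hNb⟩ := main b hb hbu
  obtain rfl : a = a' := h.matching b a a' hbu hau ha'u hab.symm hba'
  have hSbu : p.toSubgraph.Adj b u := by rw [adj_iff, hNb]; simp
  have hNu : p.toSubgraph.neighborSet u = {a, b} := by
    obtain ⟨y, z, hyz, hN⟩ := two u hu
    have h1 : a ∈ ({y, z} : Set V) := hN ▸ hSau.symm
    have h2 : b ∈ ({y, z} : Set V) := hN ▸ hSbu.symm
    have h3 := hab.ne
    rw [hN]
    simp only [Set.mem_insert_iff, Set.mem_singleton_iff] at h1 h2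
    rcases h1 with rfl | rfl <;> rcases h2 with rfl | rfl
    · exact absurd rfl h3
    · rfl
    · exact Set.pair_comm _ _
    · exact absurd rfl h3
  have hverts : p.toSubgraph.verts = {u, a, b} := by
    ext w
    refine ⟨fun hw => ?_, ?_⟩
    · by_cases hwu : w = u
      · exact Or.inl hwu
      · obtain ⟨c, -, -, hNw⟩ := main w hw hwu
        have : p.toSubgraph.Adj w u := by rw [adj_iff, hNw]; simp
        have := this.symm
        rw [adj_iff, hNu] at this
        exact Or.inr this
    · rintro (rfl | rfl | rfl) <;> assumption
  refine ⟨b, hbu, hab, hverts, fun x y => ⟨fun hxy => ?_, ?_⟩⟩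
  · exact ⟨hxy.adj_sub.ne, hverts ▸ hxy.fst_mem, hverts ▸ hxy.snd_mem⟩
  · rintro ⟨hne, rfl | rfl | rfl, rfl | rfl | rfl⟩ <;>
      first
      | exact absurd rfl hne
      | assumption
      | exact SimpleGraph.Subgraph.Adj.symm ‹_›

theorem isCactus (h : IsWindmill K u) : IsCactus K := by
  intro v w p q hp hq hne
  by_contra hs
  rw [Set.not_subsingleton_iff] at hs
  obtain ⟨x, hx, y, hy, hxy⟩ := hs
  obtain ⟨a, ⟨hap, haq⟩, hau⟩ :
      ∃ a, a ∈ p.toSubgraph.verts ∩ q.toSubgraph.verts ∧ a ≠ u := by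
    by_cases hxu : x = u
    · exact ⟨y, hy, fun hyu => hxy (hxu.trans hyu.symm)⟩
    · exact ⟨x, hx, hxu⟩
  obtain ⟨b, hbu, hab, hv, hadj⟩ := h.cycle_eq p hp hap hau
  obtain ⟨c, hcu, hac, hv', hadj'⟩ := h.cycle_eq q hq haq hau
  obtain rfl := h.matching a b c hau hbu hcu hab hac
  refine hne (SimpleGraph.Subgraph.ext (hv.trans hv'.symm) ?_)
  ext x y
  rw [hadj, hadj']

theorem comap {W : Type*} (h : IsWindmill K u) (e : W ≃ V) :
    IsWindmill (K.comap e) (e.symm u) := by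
  have hne : ∀ w, w ≠ e.symm u → e w ≠ u := fun w hw he => hw (by simp [← he])
  refine ⟨fun v hv => ?_, fun a b c ha hb hc hab hac => ?_, fun v w hv hw hv' hw' => ?_⟩
  · simpa using h.adj_center _ (hne v hv)
  · exact e.injective (h.matching _ _ _ (hne a ha) (hne b hb) (hne c hc) hab hac)
  · refine e.injective (h.uncovered _ _ (hne v hv) (hne w hw) (fun b hb hvb => ?_)
      fun b hb hwb => ?_)
    · exact hv' (e.symm b) (by simpa using hb) (by simpa using hvb)
    · exact hw' (e.symm b) (by simpa using hb) (by simpa using hwb)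

end IsWindmill

theorem isWindmill_H (m : ℕ) : IsWindmill (H (m + 1)) 0 := by
  have adj : ∀ i j : Fin (m + 1), i ≠ 0 → j ≠ 0 → ((H (m + 1)).Adj i j ↔
      (Odd (i : ℕ) ∧ (j : ℕ) = i + 1) ∨ (Odd (j : ℕ) ∧ (i : ℕ) = j + 1)) := by
    intro i j hi hj
    have hi' : (i : ℕ) ≠ 0 := Fin.val_ne_zero_iff.2 hi
    have hj' : (j : ℕ) ≠ 0 := Fin.val_ne_zero_iff.2 hj
    simp only [H, SimpleGraph.fromRel_adj, hi', hj', false_or, ne_eq, Fin.ext_iff]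
    constructor
    · exact fun h => h.2
    · exact fun h => ⟨by omega, h⟩
  -- Odd values pair with their successor and even nonzero ones with their predecessor; only the
  -- last vertex can lack a partner.
  have unc : ∀ v : Fin (m + 1), v ≠ 0 → (∀ b, b ≠ 0 → ¬ (H (m + 1)).Adj v b) → (v : ℕ) = m := by
    intro v hv hb
    have hv' : (v : ℕ) ≠ 0 := Fin.val_ne_zero_iff.2 hv
    by_contra hvm
    have hlt := v.2
    rcases Nat.even_or_odd (v : ℕ) with he | ho
    · have h2 : 2 ≤ (v : ℕ) := by rcases he with ⟨k, hk⟩; omega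
      have hb0 : (⟨v - 1, by omega⟩ : Fin (m + 1)) ≠ 0 := by
        simp only [ne_eq, Fin.ext_iff, Fin.val_zero]; omega
      refine hb _ hb0 ((adj _ _ hv hb0).2 (Or.inr ⟨?_, ?_⟩))
      · rcases he with ⟨k, hk⟩
        exact ⟨k - 1, by simp only; omega⟩
      · simp only; omega
    · have hb0 : (⟨v + 1, by omega⟩ : Fin (m + 1)) ≠ 0 := by
        simp only [ne_eq, Fin.ext_iff, Fin.val_zero]; omega
      exact hb _ hb0 ((adj _ _ hv hb0).2 (Or.inl ⟨ho, rfl⟩))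
  refine ⟨fun v hv => ?_, fun a b c ha hb hc hab hac => ?_, fun v w hv hw hv' hw' => ?_⟩
  · simp [H, hv.symm]
  · rw [adj _ _ ha hb] at hab
    rw [adj _ _ ha hc] at hac
    ext
    simp only [Nat.odd_iff] at hab hac
    omega
  · ext
    rw [unc v hv hv', unc w hw hw']

/-! ### Splitting sums over edges along a rooted tree -/

section Counting

variable (G : SimpleGraph V) (u : V) (p : V → V)

/-- The edges of `G` that do not join a vertex `v ≠ u` to its parent `p v`. -/
def OffTree (v w : V) : Prop :=
  G.Adj v w ∧ ¬ (v ≠ u ∧ p v = w) ∧ ¬ (w ≠ u ∧ p w = v)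

/-- Every vertex other than the root `u` has a parent in `G`, and no two vertices are parents of
each other. -/
structure IsParentMap : Prop where
  adj : ∀ v, v ≠ u → G.Adj v (p v)
  asymm : ∀ v, v ≠ u → p v ≠ u → p (p v) ≠ v

variable {G u p}

theorem OffTree.symm {v w : V} (h : OffTree G u p v w) : OffTree G u p w v :=
  ⟨h.1.symm, h.2.2, h.2.1⟩

open scoped Classical

/-- General values serve both the edge count (`f = 1`) and the quadratic form (`f v w = x v * x w`).
-/
theorem IsParentMap.sum_adj [Fintype V] {R : Type*} [AddCommMonoid R] (h : IsParentMap G u p)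
    (f : V → V → R) :
    (∑ v, ∑ w, if G.Adj v w then f v w else 0) =
      (∑ v, if v ≠ u then f v (p v) else 0) + (∑ v, if v ≠ u then f (p v) v else 0) +
        ∑ v, ∑ w, if OffTree G u p v w then f v w else 0 := by
  have h1 : (∑ v, if v ≠ u then f v (p v) else 0) =
      ∑ v, ∑ w, if v ≠ u ∧ p v = w then f v w else 0 := by
    refine Finset.sum_congr rfl fun v _ => ?_
    by_cases hv : v = u <;> simp [hv]
  have h2 : (∑ v, if v ≠ u then f (p v) v else 0) =
      ∑ v, ∑ w, if w ≠ u ∧ p w = v then f v w else 0 := by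
    rw [Finset.sum_comm]
    refine Finset.sum_congr rfl fun v _ => ?_
    by_cases hv : v = u <;> simp [hv]
  rw [h1, h2, ← Finset.sum_add_distrib, ← Finset.sum_add_distrib]
  refine Finset.sum_congr rfl fun v _ => ?_
  rw [← Finset.sum_add_distrib, ← Finset.sum_add_distrib]
  refine Finset.sum_congr rfl fun w _ => ?_
  by_cases hv : v ≠ u ∧ p v = w
  · have hw : ¬ (w ≠ u ∧ p w = v) := by
      rintro ⟨hw, hpw⟩
      obtain ⟨hv, rfl⟩ := hv
      exact h.asymm v hv hw hpw
    have hvw : G.Adj v w := hv.2 ▸ h.adj v hv.1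
    simp [OffTree, hv, hw, hvw]
  · by_cases hw : w ≠ u ∧ p w = v
    · have hvw : G.Adj v w := hw.2 ▸ (h.adj w hw.1).symm
      simp [OffTree, hv, hw, hvw]
    · rw [if_neg hv, if_neg hw, zero_add, zero_add]
      exact if_congr ⟨fun hvw => ⟨hvw, hv, hw⟩, fun hvw => hvw.1⟩ rfl rfl

theorem sum_adj_one [Fintype V] (G : SimpleGraph V) :
    (∑ v, ∑ w, if G.Adj v w then 1 else 0) = 2 * G.edgeSet.ncard := by
  rw [Set.ncard_eq_toFinset_card', ← SimpleGraph.edgeFinset, ← G.sum_degrees_eq_twice_card_edges]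
  refine Finset.sum_congr rfl fun v _ => ?_
  rw [← SimpleGraph.card_neighborFinset_eq_degree, SimpleGraph.neighborFinset_eq_filter,
    Finset.card_filter]

/-- The vertices covered by edges outside the tree. -/
noncomputable def covered [Fintype V] (G : SimpleGraph V) (u : V) (p : V → V) : Finset V :=
  Finset.univ.filter fun v => ∃ w, OffTree G u p v w

theorem mem_covered [Fintype V] {v : V} :
    v ∈ covered G u p ↔ ∃ w, OffTree G u p v w := by
  simp [covered]

/-- When the off-tree edges form a matching, each covered vertex starts exactly one ordered off-tree
pair. -/
theorem IsParentMap.two_mul_ncard [Fintype V] (h : IsParentMap G u p)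
    (hm : ∀ a b c, OffTree G u p a b → OffTree G u p a c → b = c) :
    2 * G.edgeSet.ncard = 2 * (Fintype.card V - 1) + (covered G u p).card := by
  have h1 : (∑ v : V, if v ≠ u then 1 else 0) = Fintype.card V - 1 := by
    rw [← Finset.card_filter, Finset.filter_ne' Finset.univ u,
      Finset.card_erase_of_mem (Finset.mem_univ u), Finset.card_univ]
  have h2 : (∑ v, ∑ w, if OffTree G u p v w then 1 else 0) = (covered G u p).card := by
    rw [covered, Finset.card_filter]
    refine Finset.sum_congr rfl fun v _ => ?_
    split_ifs with hv
    · obtain ⟨w, hw⟩ := hv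
      rw [Finset.sum_eq_single w]
      · rw [if_pos hw]
      · exact fun b _ hb => if_neg fun hvb => hb (hm v b w hvb hw)
      · simp
    · push Not at hv
      exact Finset.sum_eq_zero fun w _ => if_neg (hv w)
  rw [← sum_adj_one, h.sum_adj, h1, h2, two_mul]

theorem card_covered_le [Fintype V] (hu : ∀ b, ¬ OffTree G u p u b) :
    (covered G u p).card ≤ Fintype.card V - 1 := by
  rw [← Finset.card_univ, ← Finset.card_erase_of_mem (Finset.mem_univ u)]
  refine Finset.card_le_card fun v hv => Finset.mem_erase.2 ⟨?_, Finset.mem_univ v⟩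
  rintro rfl
  obtain ⟨w, hw⟩ := mem_covered.1 hv
  exact hu w hw

end Counting

namespace IsWindmill

variable {K : SimpleGraph V} {u : V}

theorem isParentMap (h : ∀ v, v ≠ u → K.Adj u v) : IsParentMap K u fun _ => u :=
  ⟨fun v hv => (h v hv).symm, fun _ _ hu => absurd rfl hu⟩

theorem offTree_iff {v w : V} :
    OffTree K u (fun _ => u) v w ↔ K.Adj v w ∧ v ≠ u ∧ w ≠ u := by
  constructor
  · rintro ⟨hvw, h1, h2⟩
    by_cases hv : v = u
    · subst hv
      exact absurd ⟨hvw.ne', rfl⟩ h2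
    · exact ⟨hvw, hv, fun hw => h1 ⟨hv, hw.symm⟩⟩
  · rintro ⟨hvw, hv, hw⟩
    exact ⟨hvw, fun h => hw h.2.symm, fun h => hv h.2.symm⟩

theorem le_ncard_edgeSet [Fintype V] (h : IsWindmill K u) :
    Fintype.card V - 1 + (Fintype.card V - 1) / 2 ≤ K.edgeSet.ncard := by
  classical
  have h1 := (isParentMap h.adj_center).two_mul_ncard fun a b c hab hac => by
    rw [offTree_iff] at hab hac
    exact h.matching a b c hab.2.1 hab.2.2 hac.2.2 hab.1 hac.1
  have h2 : ((covered K u fun _ => u)ᶜ.erase u).card ≤ 1 := by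
    refine Finset.card_le_one.2 fun v hv w hw => ?_
    simp only [Finset.mem_erase, Finset.mem_compl, mem_covered, offTree_iff, not_exists] at hv hw
    exact h.uncovered v w hv.1 hw.1 (fun b hb hvb => hv.2 b ⟨hvb, hv.1, hb⟩)
      fun b hb hwb => hw.2 b ⟨hwb, hw.1, hb⟩
  have h3 := Finset.pred_card_le_card_erase (a := u) (s := (covered K u fun _ => u)ᶜ)
  rw [Finset.card_compl] at h3
  omega

end IsWindmill

/-! ### Breadth-first trees in a cactus -/

section BreadthFirst

variable {G : SimpleGraph V}

/-- Every vertex of a shortest walk other than its end `v` is strictly nearer to `u` than `v` is. -/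
theorem exists_walk_notMem_support (hG : G.Connected) {u v a : V} (hva : v ≠ a)
    (h : G.dist u v ≤ G.dist u a) : ∃ q : G.Walk u v, a ∉ q.support := by
  classical
  obtain ⟨q, hq⟩ := hG.exists_walk_length_eq_dist u v
  refine ⟨q, fun ha => ?_⟩
  have h1 := congrArg SimpleGraph.Walk.length (q.take_spec ha)
  rw [SimpleGraph.Walk.length_append] at h1
  have h2 := SimpleGraph.dist_le (q.takeUntil a ha)
  have h3 : (q.dropUntil a ha).length = 0 := by omega
  exact hva (SimpleGraph.Walk.eq_of_length_eq_zero h3).symm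

theorem exists_cycle_of_walk {a b c : V} (hab : G.Adj a b) (hac : G.Adj a c) (hbc : b ≠ c)
    (q : G.Walk c b) (hq : a ∉ q.support) :
    ∃ r : G.Walk a a, r.IsCycle ∧ c ∈ r.support ∧
      ∀ x, r.toSubgraph.Adj a x ↔ x = b ∨ x = c := by
  classical
  have hq' : a ∉ q.bypass.support := fun h => hq (q.support_bypass_subset_support h)
  have hedge : ∀ x, s(a, x) ∉ q.bypass.edges :=
    fun x hx => hq' (q.bypass.fst_mem_support_of_mem_edges hx)
  refine ⟨SimpleGraph.Walk.cons hac (q.bypass.concat hab.symm), ?_, ?_, fun x => ?_⟩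
  · rw [SimpleGraph.Walk.cons_isCycle_iff, SimpleGraph.Walk.edges_concat]
    refine ⟨q.bypass_isPath.concat hq' hab.symm, ?_⟩
    simp [hedge, hbc.symm, hab.ne]
  · simp [SimpleGraph.Walk.support_concat]
  · rw [SimpleGraph.Walk.adj_toSubgraph_iff_mem_edges, SimpleGraph.Walk.edges_cons,
      SimpleGraph.Walk.edges_concat]
    have hb := hab.ne
    have hc := hac.ne
    simp only [List.concat_eq_append, List.mem_cons, List.mem_append, hedge, false_or,
      List.not_mem_nil, or_false, Sym2.eq_iff]
    grind

/-- `p` sends every vertex other than `u` to a neighbour that is nearer to `u`. -/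
def IsBreadthFirst (G : SimpleGraph V) (u : V) (p : V → V) : Prop :=
  ∀ v, v ≠ u → G.Adj v (p v) ∧ G.dist u (p v) < G.dist u v

theorem exists_isBreadthFirst (hG : G.Connected) (u : V) : ∃ p, IsBreadthFirst G u p := by
  have : ∀ v, ∃ w, v ≠ u → G.Adj v w ∧ G.dist u w < G.dist u v := by
    intro v
    by_cases hv : v = u
    · exact ⟨v, fun h => absurd hv h⟩
    obtain ⟨q, hq⟩ := hG.exists_walk_length_eq_dist v u
    cases q with
    | nil => exact absurd rfl hv
    | @cons _ w _ hvw r =>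
      refine ⟨w, fun _ => ⟨hvw, ?_⟩⟩
      have h1 := SimpleGraph.dist_le r
      rw [SimpleGraph.Walk.length_cons] at hq
      rw [SimpleGraph.dist_comm, SimpleGraph.dist_comm (u := u)]
      omega
  choose p hp using this
  exact ⟨p, hp⟩

namespace IsBreadthFirst

variable {u : V} {p : V → V}

theorem isParentMap (hp : IsBreadthFirst G u p) : IsParentMap G u p := by
  refine ⟨fun v hv => (hp v hv).1, fun v hv hpv hpp => ?_⟩
  have h1 := (hp v hv).2
  have h2 := (hp (p v) hpv).2
  rw [hpp] at h2
  omega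

theorem parent_eq_of_adj (hG : G.Connected) (hp : IsBreadthFirst G u p) {v : V}
    (h : G.Adj u v) : p v = u := by
  have h1 := (hp v h.ne').2
  rw [SimpleGraph.dist_eq_one_iff_adj.2 h] at h1
  exact ((hG.dist_eq_zero_iff).1 (by omega)).symm

theorem not_offTree_root (hG : G.Connected) (hp : IsBreadthFirst G u p) (b : V) :
    ¬ OffTree G u p u b :=
  fun h => h.2.2 ⟨h.1.ne', hp.parent_eq_of_adj hG h.1⟩

/-- An edge `ab` outside the tree closes a cycle whose edges at `a` are `ab` and the tree edge from
`a` to its parent. -/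
theorem exists_cycle (hG : G.Connected) (hp : IsBreadthFirst G u p) {a b : V}
    (h : OffTree G u p a b) :
    ∃ r : G.Walk a a, r.IsCycle ∧ p a ∈ r.support ∧
      ∀ x, r.toSubgraph.Adj a x ↔ x = b ∨ x = p a := by
  have hau : a ≠ u := by
    rintro rfl
    exact hp.not_offTree_root hG b h
  have hbu : b ≠ u := by
    rintro rfl
    exact hp.not_offTree_root hG a h.symm
  obtain ⟨hadj, hlt⟩ := hp a hau
  obtain ⟨hadjb, hltb⟩ := hp b hbu
  have hbp : b ≠ p a := fun hb => h.2.1 ⟨hau, hb.symm⟩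
  have hpb : p b ≠ a := fun hb => h.2.2 ⟨hbu, hb⟩
  obtain ⟨q₁, hq₁⟩ := exists_walk_notMem_support hG hadj.ne' hlt.le
  obtain ⟨q₂, hq₂⟩ : ∃ q : G.Walk u b, a ∉ q.support := by
    -- The parent of `b` is at most as far from `u` as `a`, since `b` is at most one step farther; a
    -- shortest walk to `p b` avoids `a` and is then prolonged to `b`.
    have htri := hG.dist_triangle (u := u) (v := a) (w := b)
    rw [SimpleGraph.dist_eq_one_iff_adj.2 h.1] at htri
    obtain ⟨q, hq⟩ := exists_walk_notMem_support (v := p b) (a := a) (u := u) hG hpb (by omega)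
    refine ⟨q.concat hadjb.symm, ?_⟩
    simp [SimpleGraph.Walk.support_concat, hq, h.1.ne]
  obtain ⟨r, hr, hc, hx⟩ := exists_cycle_of_walk h.1 hadj hbp (q₁.reverse.append q₂) (by
    simp [SimpleGraph.Walk.mem_support_append_iff, hq₁, hq₂])
  exact ⟨r, hr, hc, hx⟩

theorem offTree_unique (hG : G.Connected) (hc : IsCactus G) (hp : IsBreadthFirst G u p)
    (a b c : V) (hb : OffTree G u p a b) (hc' : OffTree G u p a c) : b = c := by
  by_contra hbc
  have hau : a ≠ u := by
    rintro rfl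
    exact hp.not_offTree_root hG b hb
  obtain ⟨r, hr, hpr, hxr⟩ := hp.exists_cycle hG hb
  obtain ⟨s, hs, hps, hxs⟩ := hp.exists_cycle hG hc'
  have hne : r.toSubgraph ≠ s.toSubgraph := by
    intro heq
    have h1 := (hxr b).2 (Or.inl rfl)
    rw [heq, hxs] at h1
    rcases h1 with h1 | h1
    · exact hbc h1
    · exact hb.2.1 ⟨hau, h1.symm⟩
  refine (hp a hau).1.ne (hc r s hr hs hne ⟨?_, ?_⟩ ⟨?_, ?_⟩)
  · exact r.mem_verts_toSubgraph.2 r.start_mem_support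
  · exact s.mem_verts_toSubgraph.2 s.start_mem_support
  · exact r.mem_verts_toSubgraph.2 hpr
  · exact s.mem_verts_toSubgraph.2 hps

end IsBreadthFirst

theorem IsCactus.ncard_edgeSet_le [Fintype V] (hc : IsCactus G) (hG : G.Connected) :
    G.edgeSet.ncard ≤ Fintype.card V - 1 + (Fintype.card V - 1) / 2 := by
  obtain ⟨u⟩ := hG.nonempty
  obtain ⟨p, hp⟩ := exists_isBreadthFirst hG u
  have h1 := hp.isParentMap.two_mul_ncard (hp.offTree_unique hG hc)
  have h2 := card_covered_le (hp.not_offTree_root hG)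
  omega

end BreadthFirst

/-! ### Replacing the tree by a star -/

/-- The star centred at `u` together with the edges of `G` outside the tree. -/
def starWith (G : SimpleGraph V) (u : V) (p : V → V) : SimpleGraph V where
  Adj v w := v ≠ w ∧ (v = u ∨ w = u ∨ OffTree G u p v w)
  symm := ⟨fun _ _ h => ⟨h.1.symm, h.2.elim (fun h => Or.inr (Or.inl h))
    fun h => h.elim Or.inl fun h => Or.inr (Or.inr h.symm)⟩⟩
  loopless := ⟨fun _ h => h.1 rfl⟩

section StarWith

variable {G : SimpleGraph V} {u : V} {p : V → V}

theorem starWith_adj_center (v : V) (hv : v ≠ u) : (starWith G u p).Adj u v :=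
  ⟨hv.symm, Or.inl rfl⟩

theorem offTree_starWith (hu : ∀ b, ¬ OffTree G u p u b) (v w : V) :
    OffTree (starWith G u p) u (fun _ => u) v w ↔ OffTree G u p v w := by
  rw [IsWindmill.offTree_iff]
  constructor
  · rintro ⟨⟨-, h⟩, hv, hw⟩
    simpa [hv, hw] using h
  · intro h
    refine ⟨⟨h.1.ne, Or.inr (Or.inr h)⟩, ?_, ?_⟩
    · rintro rfl
      exact hu w h
    · rintro rfl
      exact hu v h.symm

theorem IsMaxEdgeConnectedCactus.le_ncard_edgeSet [Fintype V] (hG : IsMaxEdgeConnectedCactus G) :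
    Fintype.card V - 1 + (Fintype.card V - 1) / 2 ≤ G.edgeSet.ncard := by
  have := hG.connected.nonempty
  obtain ⟨m, hm⟩ : ∃ m, Fintype.card V = m + 1 :=
    Nat.exists_eq_succ_of_ne_zero Fintype.card_ne_zero
  have hK := (isWindmill_H m).comap (Fintype.equivFinOfCardEq hm)
  exact hK.le_ncard_edgeSet.trans (hG.card_edges_le _ hK.connected hK.isCactus)

theorem isWindmill_starWith [Fintype V] (hG : IsMaxEdgeConnectedCactus G)
    (hp : IsBreadthFirst G u p) : IsWindmill (starWith G u p) u := by
  classical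
  have hu := hp.not_offTree_root hG.connected
  have hm := hp.offTree_unique hG.connected hG.isCactus
  have off : ∀ a b, a ≠ u → b ≠ u → ((starWith G u p).Adj a b ↔ OffTree G u p a b) := by
    intro a b ha hb
    rw [← offTree_starWith hu, IsWindmill.offTree_iff]
    simp [ha, hb]
  refine ⟨starWith_adj_center, fun a b c ha hb hc hab hac => ?_, fun v w hv hw hv' hw' => ?_⟩
  · exact hm a b c ((off a b ha hb).1 hab) ((off a c ha hc).1 hac)
  · by_contra hvw
    have h1 := hp.isParentMap.two_mul_ncard hm
    have h2 := hG.le_ncard_edgeSet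
    have unc : ∀ x, x ≠ u → (∀ b, b ≠ u → ¬ (starWith G u p).Adj x b) →
        x ∉ covered G u p := by
      intro x hx hx' hmem
      obtain ⟨b, hb⟩ := mem_covered.1 hmem
      have hbu : b ≠ u := by
        rintro rfl
        exact hu x hb.symm
      exact hx' b hbu ((off x b hx hbu).2 hb)
    -- Three vertices missed by the matching would leave `G` at least one edge short of the maximum.
    have h3 : ({u, v, w} : Finset V) ⊆ (covered G u p)ᶜ := by
      intro x hx
      simp only [Finset.mem_insert, Finset.mem_singleton] at hx
      rw [Finset.mem_compl]
      rcases hx with rfl | rfl | rfl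
      · exact fun hmem => (mem_covered.1 hmem).elim hu
      · exact unc _ hv hv'
      · exact unc _ hw hw'
    have h4 := Finset.card_le_card h3
    rw [Finset.card_compl, Finset.card_eq_three.2 ⟨u, v, w, hv.symm, hw.symm, hvw, rfl⟩] at h4
    omega

open Matrix in
open scoped Classical in
theorem dotProduct_adjMatrix_le_starWith [Fintype V] (hG : G.Connected)
    (hp : IsBreadthFirst G u p) {x : V → ℝ} (hx : ∀ v, 0 ≤ x v) (hu : ∀ v, x v ≤ x u) :
    x ⬝ᵥ (G.adjMatrix ℝ *ᵥ x) ≤ x ⬝ᵥ ((starWith G u p).adjMatrix ℝ *ᵥ x) := by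
  rw [dotProduct_adjMatrix_mulVec, dotProduct_adjMatrix_mulVec, hp.isParentMap.sum_adj,
    (IsWindmill.isParentMap starWith_adj_center).sum_adj]
  simp only [offTree_starWith (hp.not_offTree_root hG)]
  refine add_le_add (add_le_add ?_ ?_) le_rfl
  · refine Finset.sum_le_sum fun v _ => ?_
    split_ifs
    · exact mul_le_mul_of_nonneg_left (hu _) (hx v)
    · exact le_rfl
  · refine Finset.sum_le_sum fun v _ => ?_
    split_ifs
    · exact mul_le_mul_of_nonneg_right (hu _) (hx v)
    · exact le_rfl

/-- If the root is adjacent to every other vertex, then replacing the tree by a star changes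
nothing. -/
theorem starWith_eq_self (hG : G.Connected) (hp : IsBreadthFirst G u p)
    (h : ∀ v, v ≠ u → G.Adj u v) : starWith G u p = G := by
  ext v w
  by_cases hv : v = u
  · subst hv
    exact ⟨fun hw => h w hw.1.symm, fun hw => ⟨hw.ne, Or.inl rfl⟩⟩
  by_cases hw : w = u
  · subst hw
    exact ⟨fun _ => (h v hv).symm, fun hw => ⟨hw.ne, Or.inr (Or.inl rfl)⟩⟩
  constructor
  · rintro ⟨-, hvw⟩
    exact ((hvw.resolve_left hv).resolve_left hw).1
  · intro hvw
    refine ⟨hvw.ne, Or.inr (Or.inr ⟨hvw, ?_, ?_⟩)⟩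
    · exact fun hpv => hw (hpv.2.symm.trans (hp.parent_eq_of_adj hG (h v hv)))
    · exact fun hpw => hv (hpw.2.symm.trans (hp.parent_eq_of_adj hG (h w hw)))

end StarWith

open Matrix in
/-- A connected cactus with the largest number of edges has a windmill on the same vertices whose
index is at least as large, with equality only for the cactus itself. -/
theorem IsMaxEdgeConnectedCactus.exists_isWindmill [Fintype V] {G : SimpleGraph V}
    (hG : IsMaxEdgeConnectedCactus G) :
    ∃ (K : SimpleGraph V) (u : V), IsWindmill K u ∧ rho G ≤ rho K ∧ (rho G = rho K → G = K) := by
  classical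
  have hc := hG.connected
  have := hc.nonempty
  obtain ⟨x, hx, hAx⟩ := exists_pos_eigenvector hc
  obtain ⟨u, hu⟩ := Finite.exists_max x
  obtain ⟨p, hp⟩ := exists_isBreadthFirst hc u
  have hle := dotProduct_adjMatrix_le_starWith hc hp (fun v => (hx v).le) hu
  have hleK := dotProduct_adjMatrix_mulVec_le (starWith G u p) x
  have heq : x ⬝ᵥ (G.adjMatrix ℝ *ᵥ x) = rho G * (x ⬝ᵥ x) := by
    convert congrArg (x ⬝ᵥ ·) hAx using 1
    · simp only [dotProduct_smul, smul_eq_mul]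
  have hpos : 0 < x ⬝ᵥ x := Finset.sum_pos (fun v _ => mul_pos (hx v) (hx v)) Finset.univ_nonempty
  refine ⟨starWith G u p, u, isWindmill_starWith hG hp, ?_, fun hrho => ?_⟩
  · refine le_of_mul_le_mul_right ?_ hpos
    rw [← heq]
    exact hle.trans hleK
  · refine (starWith_eq_self hc hp fun v hv => ?_).symm
    have hKx := adjMatrix_mulVec_eq_of_le (G := starWith G u p) (x := x) (by
      rw [← hrho, ← heq]
      exact hle)
    -- Both sides are sums of positive entries over the neighbours of `u`; a vertex not adjacent to
    -- `u` in `G` would make the star's sum strictly larger.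
    have h1 : (G.adjMatrix ℝ *ᵥ x) u = ((starWith G u p).adjMatrix ℝ *ᵥ x) u := by
      rw [hAx, hKx, hrho]
    rw [SimpleGraph.adjMatrix_mulVec_apply, SimpleGraph.adjMatrix_mulVec_apply] at h1
    by_contra hn
    refine h1.not_lt (Finset.sum_lt_sum_of_subset (i := v) ?_ ?_ ?_ (hx v) fun i _ _ => (hx i).le)
    · intro w hw
      rw [SimpleGraph.mem_neighborFinset] at hw ⊢
      exact starWith_adj_center w hw.ne'
    · rw [SimpleGraph.mem_neighborFinset]
      exact starWith_adj_center v hv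
    · rwa [SimpleGraph.mem_neighborFinset]

end CactusIndex

theorem theorem2p3 (n : ℕ) (hn : 1 ≤ n) :
    CactusIndex.IsMaxEdgeConnectedCactus (CactusIndex.H n) ∧
    ∀ (V : Type*) [Fintype V] (G : SimpleGraph V), Fintype.card V = n →
      CactusIndex.IsMaxEdgeConnectedCactus G →
        CactusIndex.rho G ≤ CactusIndex.rho (CactusIndex.H n) ∧
        (CactusIndex.rho G = CactusIndex.rho (CactusIndex.H n) ↔
          Nonempty (G ≃g CactusIndex.H n)) := by
  obtain ⟨m, rfl⟩ : ∃ m, n = m + 1 := ⟨n - 1, by omega⟩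
  have hH := CactusIndex.isWindmill_H m
  refine ⟨⟨hH.connected, hH.isCactus, fun G' hG' hc => ?_⟩, fun V _ G hV hG => ?_⟩
  · exact (hc.ncard_edgeSet_le hG').trans hH.le_ncard_edgeSet
  · obtain ⟨K, u, hK, hle, heq⟩ := hG.exists_isWindmill
    obtain ⟨e⟩ := hK.nonempty_iso hH (by simpa using hV)
    rw [← CactusIndex.rho_congr e]
    refine ⟨hle, fun h => ?_, fun ⟨f⟩ => ?_⟩
    · rw [heq h]
      exact ⟨e⟩
    · rw [CactusIndex.rho_congr f, CactusIndex.rho_congr e]
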